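/- Let $\mathbb{F}$ be a finite field of characteristic $2$ with $q$ elements, and let $A=A_0\oplus A_1$ be a finite-dimensional associative (not necessarily unital) $\mathbb{Z}_2$-graded $\mathbb{F}$-algebra such that $y^q=y$ for every $y\in A_0$. A graded simple right $A$-module is a $\mathbb{Z}_2$-graded right $A$-module $V$ (so $V=V_0\oplus V_1$ and $V_hA_g\subseteq V_{h+g}$) with $VA\neq 0$ whose only graded submodules are $0$ and $V$; the graded Jacobson radical $J^{gr}(A)$ is the intersection of the annihilators in $A$ of all graded simple right $A$-modules (and $J^{gr}(A)=A$ if there are none). A $\mathbb{Z}_2$-graded algebra $C$ is graded simple if $C^2\neq 0$ and its only graded two-sided ideals are $0$ and $C$. Then there are a graded subalgebra $B$ of $A$, an integer $r\geq 0$ and graded subalgebras $B_1,\dots,B_r$ of $A$ such that 1. $A=B\oplus J^{gr}(A)$ as a vector space; 2. $B=B_1\oplus\cdots\oplus B_r$, and each $B_i$ is a two-sided ideal of $B$; 3. each $B_i$, with the grading induced from $A$, is a graded simple algebra, and it is isomorphic, as a $\mathbb{Z}_2$-graded algebra, to one of: $\mathbb{F}$ with the trivial grading; the group algebra $\mathbb{F}[\mathbb{Z}_2]$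 with its canonical grading (for each $g\in\mathbb{Z}_2$, the component of degree $g$ is spanned by the group element $g$); or $M_2(\mathbb{F})$ with the grading whose component of degree $0$ is the set of diagonal matrices and whose component of degree $1$ is the set of matrices with zero diagonal. -/

import Mathlib

universe u v w

namespace GradedAlg

section General

variable {F : Type u} [Field F] {G : Type w} [AddGroup G] [DecidableEq G]

/-- Powers in a possibly non-unital ring: `posPow a n` is `a ^ n` for `n ≥ 1`
(the value at `n = 0` is a placeholder). -/
def posPow {A : Type v} [NonUnitalRing A] (a : A) : ℕ → A
  | 0 => 0
  | 1 => a
  | n + 2 => posPow a (n + 1) * a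

/-- A `G`-grading on a (not necessarily unital) associative `F`-algebra `A`: the vector space `A`
is the direct sum of the `𝒜 g`, and `A_g A_h ⊆ A_{g + h}`. -/
structure IsGrading {A : Type v} [NonUnitalRing A] [Module F A]
    (𝒜 : G → Submodule F A) : Prop where
  isInternal : DirectSum.IsInternal 𝒜
  mul_mem : ∀ {g h : G} {a b : A}, a ∈ 𝒜 g → b ∈ 𝒜 h → a * b ∈ 𝒜 (g + h)

/-- A graded subspace: `I = ⊕_g (I ∩ V_g)` (the sum is direct because the sum of the `V_g` is). -/
def IsGradedSubspace {V : Type v} [AddCommGroup V] [Module F V]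
    (𝒱 : G → Submodule F V) (I : Submodule F V) : Prop :=
  I = ⨆ g, I ⊓ 𝒱 g

/-- Two-sided ideals of an algebra. -/
def IsIdeal {A : Type v} [NonUnitalRing A] [Module F A] (I : Submodule F A) : Prop :=
  ∀ a : A, ∀ x ∈ I, a * x ∈ I ∧ x * a ∈ I

/-- A graded simple algebra: `A² ≠ 0` and the only graded ideals are `0` and `A`. -/
def IsGradedSimple {A : Type v} [NonUnitalRing A] [Module F A]
    (𝒜 : G → Submodule F A) : Prop :=
  (∃ a b : A, a * b ≠ 0) ∧
    ∀ I : Submodule F A, IsIdeal I → IsGradedSubspace 𝒜 I → I = ⊥ ∨ I = ⊤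

/-- A graded right `A`-module `M`. The linear map `ρ` is the right action: `ρ a m` is `m a`. -/
structure IsGradedRightModule {A : Type v} [NonUnitalRing A] [Module F A]
    (𝒜 : G → Submodule F A) {M : Type v} [AddCommGroup M] [Module F M]
    (ρ : A →ₗ[F] M →ₗ[F] M) (ℳ : G → Submodule F M) : Prop where
  act_mul : ∀ (a b : A) (m : M), ρ (a * b) m = ρ b (ρ a m)
  isInternal : DirectSum.IsInternal ℳ
  act_mem : ∀ {g h : G} {a : A} {m : M}, m ∈ ℳ h → a ∈ 𝒜 g → ρ a m ∈ ℳ (h + g)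

/-- A graded simple right `A`-module: `M A ≠ 0` and the only graded submodules are `0` and `M`. -/
structure IsGradedSimpleRightModule {A : Type v} [NonUnitalRing A] [Module F A]
    (𝒜 : G → Submodule F A) {M : Type v} [AddCommGroup M] [Module F M]
    (ρ : A →ₗ[F] M →ₗ[F] M) (ℳ : G → Submodule F M) : Prop
    extends IsGradedRightModule 𝒜 ρ ℳ where
  act_ne_zero : ∃ (a : A) (m : M), ρ a m ≠ 0
  eq_bot_or_top : ∀ N : Submodule F M, (∀ (a : A), ∀ m ∈ N, ρ a m ∈ N) →
    IsGradedSubspace ℳ N → N = ⊥ ∨ N = ⊤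

/-- The graded Jacobson radical: the intersection of the annihilators of all graded simple right
`A`-modules (all of `A` if there are none). Every graded simple right module is `m A` for a
homogeneous `m`, a quotient of the vector space `A`, so modules in the universe of `A` suffice. -/
def gradedJacobson {A : Type v} [NonUnitalRing A] [Module F A]
    (𝒜 : G → Submodule F A) : Submodule F A where
  carrier := {a | ∀ (M : Type v) [AddCommGroup M] [Module F M]
    (ρ : A →ₗ[F] M →ₗ[F] M) (ℳ : G → Submodule F M),
    IsGradedSimpleRightModule 𝒜 ρ ℳ → ∀ m : M, ρ a m = 0}
  zero_mem' := by
    intro M _ _ ρ ℳ _ m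
    simp
  add_mem' := by
    intro a b ha hb M _ _ ρ ℳ h m
    simp [ha M ρ ℳ h m, hb M ρ ℳ h m]
  smul_mem' := by
    intro c a ha M _ _ ρ ℳ h m
    simp [ha M ρ ℳ h m]

/-- The family `B ∩ A_g` of subspaces of a subalgebra `B`. -/
def inducedGrading {A : Type v} [NonUnitalRing A] [Module F A]
    (𝒜 : G → Submodule F A) (B : NonUnitalSubalgebra F A) : G → Submodule F B :=
  fun g => (𝒜 g).comap (NonUnitalSubalgebraClass.subtype B : B →ₗ[F] A)

/-- Isomorphism of graded algebras. -/
def GradedIso {A : Type v} [NonUnitalRing A] [Module F A] {C : Type*} [NonUnitalRing C]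
    [Module F C] (𝒜 : G → Submodule F A) (𝒞 : G → Submodule F C) : Prop :=
  ∃ φ : A →ₙₐ[F] C, Function.Bijective φ ∧ ∀ (g : G) (a : A), a ∈ 𝒜 g ↔ φ a ∈ 𝒞 g

end General

section Models

variable (F : Type u) [Field F]

/-- The field `F` with the trivial grading: everything has degree `0`. -/
def fieldGrading : ZMod 2 → Submodule F F :=
  fun g => if g = 0 then ⊤ else ⊥

/-- The canonical grading of the group algebra `F[ℤ₂]`: degree `g` is spanned by the group
element `g`. -/
noncomputable def groupAlgebraGrading : ZMod 2 → Submodule F (AddMonoidAlgebra F (ZMod 2)) :=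
  AddMonoidAlgebra.grade F

/-- The elementary `ℤ₂`-grading on `M₂(F)`: diagonal matrices have degree `0` and
matrices with zero diagonal have degree `1`. -/
def matrixGrading : ZMod 2 → Submodule F (Matrix (Fin 2) (Fin 2) F) := fun g =>
  { carrier := {X | (g ≠ 0 → X 0 0 = 0 ∧ X 1 1 = 0) ∧ (g ≠ 1 → X 0 1 = 0 ∧ X 1 0 = 0)}
    zero_mem' := by simp
    add_mem' := by
      rintro X Y ⟨h1, h2⟩ ⟨h3, h4⟩
      refine ⟨fun h => ?_, fun h => ?_⟩
      · simp [h1 h, h3 h]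
      · simp [h2 h, h4 h]
    smul_mem' := by
      rintro c X ⟨h1, h2⟩
      refine ⟨fun h => ?_, fun h => ?_⟩
      · simp [h1 h]
      · simp [h2 h] }

end Models

end GradedAlg

/-! The identity `y ^ q = y` makes `A₀` reduced, so its idempotents are central in `A₀`. Its
primitive idempotents `e i` are orthogonal, each corner `e i * A₀` is the line `F • e i`, and their
sum is an identity for `A₀`, though perhaps not for `A` (`exists_orthogonal_idempotents`).

Let `J` be the set of `x` in `A₁` with `x A₁ = 0`. If `x ∈ J` and `y ∈ A₁`, then `(y x)² = 0` in the
reduced ring `A₀`, so `A₁ J = 0` too. Hence `J` is an ideal of square zero and kills every graded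
simple module. Conversely, the graded simple module attached to each `e i` forces `e i * J^gr ⊆ J`,
and `J^gr = J` follows (`gradedJacobson_eq_oddRadical`).

Modulo `J`, the odd part is governed by a relation on the indices: `i` and `j` are linked when odd
elements `x`, `y` complete `e i`, `e j` to matrix units. An index has at most one partner
(`linked_unique`). Without a partner, `e i * A₁ ⊆ J` and the block is `F`. If `i` is its own
partner, a square root in `F` normalises `x * x = e i`, giving `F[ℤ₂]`. A partner `j ≠ i` gives
`M₂(F)`. The idempotents summed over link classes are orthogonal, so the blocks form a direct sum,
and this sum is a complement of `J`. -/

namespace GradedAlg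

/-! ### Powers in a non-unital ring -/

section Powers

variable {A : Type v} [NonUnitalRing A]

theorem posPow_add_two (a : A) (n : ℕ) : posPow a (n + 2) = posPow a (n + 1) * a := rfl

theorem posPow_one (a : A) : posPow a 1 = a := rfl

theorem posPow_succ_comm (a : A) (n : ℕ) : posPow a (n + 1) * a = a * posPow a (n + 1) := by
  induction n with
  | zero => rfl
  | succ n ih => rw [posPow_add_two, ih, mul_assoc, ih]

theorem posPow_eq_zero_of_mul_self {a : A} (h : a * a = 0) (n : ℕ) : posPow a (n + 2) = 0 := by
  induction n with
  | zero => exact h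
  | succ n ih => rw [posPow_add_two, ih, zero_mul]

theorem mul_posPow_of_mul_self {a f : A} (h : f * a = a) (n : ℕ) :
    f * posPow a (n + 1) = posPow a (n + 1) := by
  induction n with
  | zero => exact h
  | succ n ih => rw [posPow_add_two, ← mul_assoc, ih]

theorem mul_posPow_eq_zero {a e : A} (h : e * a = 0) (n : ℕ) :
    e * posPow a (n + 1) = 0 := by
  induction n with
  | zero => exact h
  | succ n ih => rw [posPow_add_two, ← mul_assoc, ih, zero_mul]

theorem posPow_mem {S : Type*} [SetLike S A] [MulMemClass S A] {s : S} {a : A} (h : a ∈ s)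
    (n : ℕ) : posPow a (n + 1) ∈ s := by
  induction n with
  | zero => exact h
  | succ n ih => exact mul_mem ih h

end Powers

/-! ### Algebras with `y ^ q = y`: orthogonal primitive idempotents -/

section Periodic

variable {F : Type u} [Field F] {A : Type v} [NonUnitalRing A] [Module F A]

/-- A primitive idempotent of the subalgebra `S`. -/
structure IsPrimitiveIn (S : NonUnitalSubalgebra F A) (e : A) : Prop where
  mem : e ∈ S
  ne_zero : e ≠ 0
  idem : e * e = e
  eq_zero_or_eq : ∀ f ∈ S, f * f = f → e * f = f → f = 0 ∨ f = e

variable {S : NonUnitalSubalgebra F A} {n : ℕ} (hS : ∀ y ∈ S, posPow y (n + 2) = y)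
include hS

theorem eq_zero_of_mul_self {a : A} (ha : a ∈ S) (h : a * a = 0) : a = 0 := by
  rw [← hS a ha, posPow_eq_zero_of_mul_self h]

/-- Both `e a - e a e` and `a e - e a e` have square zero, hence vanish. -/
theorem idem_central {e a : A} (he : e ∈ S) (hi : e * e = e) (ha : a ∈ S) : e * a = a * e := by
  have h1 : e * a - e * a * e = 0 := by
    refine eq_zero_of_mul_self hS (sub_mem (mul_mem he ha) (mul_mem (mul_mem he ha) he)) ?_
    have : (e * a - e * a * e) * e = 0 := by
      rw [sub_mul, mul_assoc (e * a), hi, sub_self]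
    rw [mul_sub, ← mul_assoc, this, zero_mul, zero_sub, ← mul_assoc, ← mul_assoc, this]
    simp
  have h2 : a * e - e * a * e = 0 := by
    refine eq_zero_of_mul_self hS (sub_mem (mul_mem ha he) (mul_mem (mul_mem he ha) he)) ?_
    have : e * (a * e - e * a * e) = 0 := by
      rw [mul_sub, mul_assoc e a e, ← mul_assoc e e, hi, sub_self]
    rw [sub_mul, mul_assoc, this, mul_assoc (e * a), this]
    simp
  rw [sub_eq_zero.mp h1, sub_eq_zero.mp h2]

/-- With `q = n + 2`, the power `a ^ (q - 1)` fixes `a`, hence fixes every positive power of `a`,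
itself included. -/
theorem posPow_idem {a : A} (ha : a ∈ S) : posPow a (n + 1) * posPow a (n + 1) = posPow a (n + 1) :=
  mul_posPow_of_mul_self (hS a ha) n

theorem posPow_ne_zero {a : A} (ha : a ∈ S) (h : a ≠ 0) : posPow a (n + 1) ≠ 0 := fun h0 => by
  apply h
  rw [← hS a ha, posPow_add_two, h0, zero_mul]

theorem primitive_mul_eq_zero {e e' : A} (he : IsPrimitiveIn S e) (he' : IsPrimitiveIn S e')
    (hne : e ≠ e') : e * e' = 0 := by
  have hc := idem_central hS he.mem he.idem he'.mem
  have hid : (e * e') * (e * e') = e * e' := by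
    rw [mul_assoc, ← mul_assoc e', ← hc, mul_assoc e, he'.idem, ← mul_assoc, he.idem]
  have hm := mul_mem he.mem he'.mem
  rcases he.eq_zero_or_eq _ hm hid (by rw [← mul_assoc, he.idem]) with h | h
  · exact h
  rcases he'.eq_zero_or_eq _ hm hid (by rw [hc, ← mul_assoc, he'.idem]) with h' | h'
  · exact h'
  · exact absurd (h.symm.trans h') hne

theorem exists_primitive_le [Finite A] {f : A} (hf : f ∈ S) (hi : f * f = f) (h0 : f ≠ 0) :
    ∃ e, IsPrimitiveIn S e ∧ f * e = e := by
  let T : Set A := {e | e ∈ S ∧ e ≠ 0 ∧ e * e = e ∧ f * e = e}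
  obtain ⟨e, ⟨heS, he0, hei, hfe⟩, hmin⟩ :=
    -- Idempotents are compared through their fixed sets `{x | e * x = x}`; finiteness of `A`
    -- supplies a minimal one.
    (Set.toFinite T).exists_minimalFor (fun e => {x : A | e * x = x}) T ⟨f, hf, h0, hi, hi⟩
  refine ⟨e, ⟨heS, he0, hei, fun g hg hgi heg => ?_⟩, hfe⟩
  by_cases hg0 : g = 0
  · exact Or.inl hg0
  right
  have hle : ({x : A | g * x = x} : Set A) ≤ {x : A | e * x = x} := fun x (hx : g * x = x) => by
    change e * x = x
    rw [← hx, ← mul_assoc, heg]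
  have : e ∈ {x : A | g * x = x} :=
    hmin (j := g) ⟨hg, hg0, hgi, by rw [← heg, ← mul_assoc, hfe]⟩ hle (show e * e = e from hei)
  have hge : g * e = e := this
  rw [← hge, ← idem_central hS heS hei hg, heg]

/-- The idempotent `u ^ (q - 1)` is nonzero and lies under `e`, so it equals `e`; thus `v = u ^ (q -
1) * v = 0`. -/
theorem primitive_domain {e u v : A} (he : IsPrimitiveIn S e) (hu : u ∈ S) (hu0 : u ≠ 0)
    (heu : e * u = u) (hev : e * v = v) (huv : u * v = 0) : v = 0 := by
  rcases he.eq_zero_or_eq _ (posPow_mem hu n) (posPow_idem hS hu)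
    (mul_posPow_of_mul_self heu n) with h | h
  · exact absurd h (posPow_ne_zero hS hu hu0)
  rw [← hev, ← h]
  cases n with
  | zero => exact huv
  | succ n => rw [posPow_add_two, mul_assoc, huv, mul_zero]

open Polynomial in
-- Otherwise every factor `x - c • e`, with `x = e * a`, is nonzero, and so is their product over
-- `c` in `F`, since the corner has no zero divisors. But that product is `x ^ q - x = 0`.
theorem primitive_scalar [IsScalarTower F A A] [SMulCommClass F A A] [Fintype F]
    (hn : Fintype.card F = n + 2) {e a : A}
    (he : IsPrimitiveIn S e) (ha : a ∈ S) : ∃ c : F, e * a = c • e := by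
  by_contra! hc
  set x := e * a with hx
  have hxS : x ∈ S := mul_mem he.mem ha
  have hex : e * x = x := by rw [hx, ← mul_assoc, he.idem]
  have hxe : x * e = x := by rw [← idem_central hS he.mem he.idem hxS, hex]
  -- As `A` may lack an identity, polynomials are evaluated at left multiplication by `x` and then
  -- applied to `e`, the identity of the corner.
  let T : Module.End F A := LinearMap.mulLeft F x
  have hpow : ∀ m, (T ^ (m + 1)) e = posPow x (m + 1) := by
    intro m
    induction m with
    | zero => simpa [T, posPow_one] using hxe
    | succ m ih =>
      rw [pow_succ', Module.End.mul_apply, ih, posPow_add_two, posPow_succ_comm]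
      rfl
  have hprod : ∀ s : Finset F, ∃ u ∈ S, u ≠ 0 ∧ e * u = u ∧
      (aeval T (∏ c ∈ s, (X - C c))) e = u := by
    classical
    intro s
    induction s using Finset.induction_on with
    | empty => exact ⟨e, he.mem, he.ne_zero, he.idem, by simp⟩
    | insert c s hcs ih =>
      obtain ⟨u, hu, hu0, heu, h⟩ := ih
      refine ⟨(x - c • e) * u, mul_mem (sub_mem hxS (S.smul_mem c he.mem)) hu, fun h0 => ?_, ?_, ?_⟩
      · exact hu0 (primitive_domain hS he (sub_mem hxS (S.smul_mem c he.mem))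
          (sub_ne_zero.mpr (hc c)) (by rw [mul_sub, hex, mul_smul_comm, he.idem]) heu h0)
      · rw [← mul_assoc, mul_sub, hex, mul_smul_comm, he.idem]
      · rw [Finset.prod_insert hcs, map_mul, Module.End.mul_apply, h, sub_mul, smul_mul_assoc, heu]
        simp [T, Module.algebraMap_end_apply]
  obtain ⟨u, -, hu0, -, h⟩ := hprod Finset.univ
  apply hu0
  have hq : (∏ c : F, (X - C c)) = X ^ (n + 2) - X := by
    have hdeg := FiniteField.X_pow_card_sub_X_natDegree_eq F (p := n + 2) (by omega)
    have hroots := FiniteField.roots_X_pow_card_sub_X F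
    rw [hn] at hroots
    have hmonic : (X ^ (n + 2) - X : F[X]).Monic :=
      monic_X_pow_sub (by rw [degree_X]; exact_mod_cast (by omega : 1 < n + 2))
    have := prod_multiset_X_sub_C_of_monic_of_roots_card_eq hmonic
      (by rw [hroots, hdeg, ← hn]; rfl)
    rw [hroots] at this
    exact this
  rw [← h, hq, map_sub, map_pow, aeval_X, LinearMap.sub_apply, hpow, hS x hxS]
  simp [T, hxe]

/-- The defect `b = a - (∑ e i) * a` is killed by every primitive idempotent, whereas a nonzero `b`
would have one below the idempotent `b ^ (q - 1)`. -/
theorem sum_primitive_mul [Finite A] {ι : Type*} [Fintype ι] {e : ι → A}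
    (he : ∀ f, IsPrimitiveIn S f ↔ ∃ i, e i = f) (hinj : Function.Injective e) {a : A}
    (ha : a ∈ S) : (∑ i, e i) * a = a := by
  have hp : ∀ i, IsPrimitiveIn S (e i) := fun i => (he _).2 ⟨i, rfl⟩
  have hsS : ∑ i, e i ∈ S := sum_mem fun i _ => (hp i).mem
  have hsum : ∀ j, e j * ∑ i, e i = e j := by
    intro j
    rw [Finset.mul_sum, Finset.sum_eq_single j]
    · exact (hp j).idem
    · exact fun i _ hij => primitive_mul_eq_zero hS (hp j) (hp i) (fun h => hij (hinj h).symm)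
    · simp
  by_contra hne
  set b := a - (∑ i, e i) * a with hb
  have hbS : b ∈ S := sub_mem ha (mul_mem hsS ha)
  have hb0 : b ≠ 0 := sub_ne_zero.mpr (Ne.symm hne)
  obtain ⟨f, hf, hbf⟩ := exists_primitive_le hS (posPow_mem hbS n) (posPow_idem hS hbS)
    (posPow_ne_zero hS hbS hb0)
  obtain ⟨j, rfl⟩ := (he f).1 hf
  have h1 : e j * b = 0 := by rw [hb, mul_sub, ← mul_assoc, hsum, sub_self]
  have h2 := mul_posPow_eq_zero h1 n
  rw [idem_central hS hf.mem hf.idem (posPow_mem hbS n), hbf] at h2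
  exact hf.ne_zero h2

/-- A finite-dimensional algebra over a finite field with `q` elements in which `y ^ q = y` is
spanned by orthogonal idempotents whose sum is the identity. -/
theorem exists_orthogonal_idempotents [IsScalarTower F A A] [SMulCommClass F A A]
    [Finite A] [Fintype F] (hn : Fintype.card F = n + 2) :
    ∃ (ι : Type v) (_ : Fintype ι) (e : ι → A), (∀ i, e i ∈ S) ∧ (∀ i, e i ≠ 0) ∧
      (∀ i, e i * e i = e i) ∧ (∀ i j, i ≠ j → e i * e j = 0) ∧
      (∀ i, ∀ a ∈ S, ∃ c : F, e i * a = c • e i) ∧ (∀ i, ∀ a ∈ S, e i * a = a * e i) ∧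
      (∀ a ∈ S, (∑ i, e i) * a = a) := by
  classical
  have : Fintype A := Fintype.ofFinite A
  let ι := {f : A // IsPrimitiveIn S f}
  refine ⟨ι, inferInstance, Subtype.val, fun i => i.2.mem, fun i => i.2.ne_zero,
    fun i => i.2.idem, fun i j hij => ?_, fun i a ha => ?_, fun i a ha => ?_, fun a ha => ?_⟩
  · exact primitive_mul_eq_zero hS i.2 j.2 (fun h => hij (Subtype.ext h))
  · exact primitive_scalar hS hn i.2 ha
  · exact idem_central hS i.2.mem i.2.idem ha
  · exact sum_primitive_mul hS (fun f => ⟨fun h => ⟨⟨f, h⟩, rfl⟩, by rintro ⟨i, rfl⟩; exact i.2⟩)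
      Subtype.val_injective ha

end Periodic

end GradedAlg

namespace GradedAlg

/-! ### Graded subspaces over `ℤ₂` -/

section ZModTwo

variable {F : Type u} [Field F] {V : Type v} [AddCommGroup V] [Module F V]
  {𝒱 : ZMod 2 → Submodule F V}

theorem zmod_two_cases (g : ZMod 2) : g = 0 ∨ g = 1 := by
  revert g; decide

theorem zmod_two_univ : (Set.univ : Set (ZMod 2)) = {0, 1} := by
  ext g
  simpa using zmod_two_cases g

theorem isInternal_zmod_two : DirectSum.IsInternal 𝒱 ↔ IsCompl (𝒱 0) (𝒱 1) :=
  DirectSum.isInternal_submodule_iff_isCompl 𝒱 zero_ne_one zmod_two_univ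

theorem exists_add_of_isCompl (h : IsCompl (𝒱 0) (𝒱 1)) (v : V) :
    ∃ a ∈ 𝒱 0, ∃ b ∈ 𝒱 1, a + b = v :=
  Submodule.mem_sup.mp (h.sup_eq_top ▸ Submodule.mem_top)

theorem eq_zero_of_mem_both (h : IsCompl (𝒱 0) (𝒱 1)) {v : V} (h0 : v ∈ 𝒱 0) (h1 : v ∈ 𝒱 1) :
    v = 0 :=
  Submodule.disjoint_def.mp h.disjoint v h0 h1

theorem isGradedSubspace_of_forall {I : Submodule F V}
    (h : ∀ v ∈ I, ∃ a ∈ I ⊓ 𝒱 0, ∃ b ∈ I ⊓ 𝒱 1, a + b = v) : IsGradedSubspace 𝒱 I := by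
  refine le_antisymm (fun v hv => ?_) (iSup_le fun g => inf_le_left)
  obtain ⟨a, ha, b, hb, rfl⟩ := h v hv
  exact add_mem (Submodule.mem_iSup_of_mem 0 ha) (Submodule.mem_iSup_of_mem 1 hb)

theorem isGradedSubspace_of_le {I : Submodule F V} (g : ZMod 2) (h : I ≤ 𝒱 g) :
    IsGradedSubspace 𝒱 I :=
  le_antisymm (le_iSup_of_le g (le_inf le_rfl h)) (iSup_le fun _ => inf_le_left)

theorem IsGradedSubspace.exists_ne_zero {I : Submodule F V} (h : IsGradedSubspace 𝒱 I)
    (hI : I ≠ ⊥) : ∃ g, ∃ v ∈ I, v ∈ 𝒱 g ∧ v ≠ 0 := by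
  by_contra! hc
  apply hI
  rw [h]
  refine (Submodule.eq_bot_iff _).2 fun v hv => ?_
  have : (⨆ g, I ⊓ 𝒱 g) ≤ ⊥ := iSup_le fun g x hx => (Submodule.mem_bot F).2 (hc g x hx.1 hx.2)
  exact (Submodule.mem_bot F).1 (this hv)

/-- The component of `v` in the wrong degree has its image in both degrees, so it vanishes by
injectivity. -/
theorem mem_iff_of_map {W : Type*} [AddCommGroup W] [Module F W] {𝒲 : ZMod 2 → Submodule F W}
    (hV : IsCompl (𝒱 0) (𝒱 1)) (hW : IsCompl (𝒲 0) (𝒲 1)) {ψ : V →ₗ[F] W}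
    (hψ : Function.Injective ψ) (hg : ∀ g, ∀ v ∈ 𝒱 g, ψ v ∈ 𝒲 g) (g : ZMod 2) (v : V) :
    ψ v ∈ 𝒲 g ↔ v ∈ 𝒱 g := by
  refine ⟨fun h => ?_, hg g v⟩
  obtain ⟨a, ha, b, hb, rfl⟩ := exists_add_of_isCompl hV v
  rw [map_add] at h
  rcases zmod_two_cases g with rfl | rfl
  · have : ψ b = 0 :=
      eq_zero_of_mem_both hW ((Submodule.add_mem_iff_right _ (hg 0 a ha)).1 h) (hg 1 b hb)
    rw [(map_eq_zero_iff ψ hψ).1 this, add_zero]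
    exact ha
  · have : ψ a = 0 :=
      eq_zero_of_mem_both hW (hg 0 a ha) ((Submodule.add_mem_iff_left _ (hg 1 b hb)).1 h)
    rw [(map_eq_zero_iff ψ hψ).1 this, zero_add]
    exact hb

end ZModTwo

/-! ### Graded simplicity of the three models -/

section Models

variable (F : Type u) [Field F]

theorem fieldGrading_isCompl : IsCompl (fieldGrading F 0) (fieldGrading F 1) := by
  have h : fieldGrading F 0 = ⊤ := if_pos rfl
  have h' : fieldGrading F 1 = ⊥ := if_neg one_ne_zero
  rw [h, h']
  exact isCompl_top_bot

theorem fieldGrading_isGradedSimple : IsGradedSimple (fieldGrading F) := by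
  refine ⟨⟨1, 1, by simp⟩, fun I hI _ => ?_⟩
  rw [or_iff_not_imp_left, ← ne_eq, Submodule.ne_bot_iff]
  rintro ⟨x, hx, hx0⟩
  refine eq_top_iff.2 fun y _ => ?_
  simpa [hx0] using (hI (y * x⁻¹) x hx).1

theorem groupAlgebraGrading_isCompl :
    IsCompl (groupAlgebraGrading F 0) (groupAlgebraGrading F 1) :=
  isInternal_zmod_two.1 (AddMonoidAlgebra.grade.isInternal)

theorem groupAlgebraGrading_isGradedSimple : IsGradedSimple (groupAlgebraGrading F) := by
  refine ⟨⟨1, 1, by simp⟩, fun I hI hgr => ?_⟩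
  rw [or_iff_not_imp_left]
  intro hne
  obtain ⟨g, v, hv, hvg, hv0⟩ := hgr.exists_ne_zero hne
  obtain ⟨c, rfl⟩ := (AddMonoidAlgebra.mem_grade_iff' F g v).1 hvg
  have hc : c ≠ 0 := by
    rintro rfl
    simp at hv0
  have h1 : (1 : AddMonoidAlgebra F (ZMod 2)) ∈ I := by
    have := (hI (AddMonoidAlgebra.single (-g) c⁻¹) _ hv).1
    rwa [AddMonoidAlgebra.lsingle_apply, AddMonoidAlgebra.single_mul_single, neg_add_cancel,
      inv_mul_cancel₀ hc] at this
  exact eq_top_iff.2 fun y _ => by simpa using (hI y 1 h1).1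

theorem matrixGrading_isCompl : IsCompl (matrixGrading F 0) (matrixGrading F 1) := by
  refine ⟨Submodule.disjoint_def.2 ?_, codisjoint_iff.2 (eq_top_iff.2 fun X _ => ?_)⟩
  · rintro X ⟨-, h⟩ ⟨h', -⟩
    have h := h zero_ne_one
    have h' := h' one_ne_zero
    ext i j
    fin_cases i <;> fin_cases j <;> simp [h, h']
  · refine Submodule.mem_sup.2 ⟨!![X 0 0, 0; 0, X 1 1], ?_, !![0, X 0 1; X 1 0, 0], ?_, ?_⟩
    · exact ⟨fun h => absurd rfl h, fun _ => by simp⟩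
    · exact ⟨fun _ => by simp, fun h => absurd rfl h⟩
    · ext i j
      fin_cases i <;> fin_cases j <;> simp

theorem matrixGrading_isGradedSimple : IsGradedSimple (matrixGrading F) := by
  refine ⟨⟨1, 1, by simp⟩, fun I hI _ => ?_⟩
  rw [or_iff_not_imp_left, ← ne_eq, Submodule.ne_bot_iff]
  rintro ⟨X, hX, hX0⟩
  obtain ⟨a, b, hab⟩ : ∃ a b, X a b ≠ 0 := by
    by_contra! hc
    exact hX0 (Matrix.ext hc)
  have hsingle : ∀ c d, Matrix.single c d (1 : F) ∈ I := by
    intro c d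
    have h1 := (hI (Matrix.single c a 1) X hX).1
    have h2 := (hI (Matrix.single b d 1) _ h1).2
    rw [Matrix.single_mul_mul_single] at h2
    have h3 := I.smul_mem (X a b)⁻¹ h2
    simpa [Matrix.smul_single, hab] using h3
  refine eq_top_iff.2 fun Y _ => ?_
  rw [Matrix.matrix_eq_sum_single Y]
  refine sum_mem fun i _ => sum_mem fun j _ => ?_
  simpa [Matrix.smul_single] using I.smul_mem (Y i j) (hsingle i j)

end Models

/-! ### Transport along graded homomorphisms -/

section Transport

variable {F : Type u} [Field F] {A : Type v} [NonUnitalRing A] [Module F A]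
  {𝒜 : ZMod 2 → Submodule F A}
  {D : Type w} [NonUnitalRing D] [Module F D] {𝒟 : ZMod 2 → Submodule F D}
  (ψ : D →ₙₐ[F] A)

theorem range_isGradedSubspace (hD : IsCompl (𝒟 0) (𝒟 1)) (hg : ∀ g, ∀ v ∈ 𝒟 g, ψ v ∈ 𝒜 g) :
    IsGradedSubspace 𝒜 (NonUnitalAlgHom.range ψ).toSubmodule := by
  refine isGradedSubspace_of_forall ?_
  rintro _ ⟨d, rfl⟩
  obtain ⟨a, ha, b, hb, rfl⟩ := exists_add_of_isCompl hD d
  exact ⟨ψ a, ⟨⟨a, rfl⟩, hg 0 a ha⟩, ψ b, ⟨⟨b, rfl⟩, hg 1 b hb⟩, (map_add ψ a b).symm⟩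

theorem range_gradedIso (hA : IsCompl (𝒜 0) (𝒜 1)) (hD : IsCompl (𝒟 0) (𝒟 1))
    (hψ : Function.Injective ψ) (hg : ∀ g, ∀ v ∈ 𝒟 g, ψ v ∈ 𝒜 g) :
    GradedIso (inducedGrading 𝒜 (NonUnitalAlgHom.range ψ)) 𝒟 := by
  let f : D →ₙₐ[F] NonUnitalAlgHom.range ψ :=
    NonUnitalAlgHom.codRestrict ψ (NonUnitalAlgHom.range ψ) (fun d => ⟨d, rfl⟩)
  have hf : Function.Bijective f := by
    refine ⟨fun a b h => hψ (congrArg Subtype.val h), ?_⟩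
    rintro ⟨_, d, rfl⟩
    exact ⟨d, rfl⟩
  let E := Equiv.ofBijective f hf
  have hE : ∀ x, f (E.symm x) = x := E.apply_symm_apply
  let φ : NonUnitalAlgHom.range ψ →ₙₐ[F] D :=
    { toFun := E.symm
      map_smul' := fun c x => hf.1 (by simp [hE])
      map_zero' := hf.1 (by simp [hE])
      map_add' := fun x y => hf.1 (by simp [hE])
      map_mul' := fun x y => hf.1 (by simp [hE]) }
  refine ⟨φ, E.symm.bijective, fun g a => ?_⟩
  obtain ⟨d, rfl⟩ := hf.2 a
  have : φ (f d) = d := E.symm_apply_apply d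
  rw [this]
  exact mem_iff_of_map (ψ := (ψ : D →ₗ[F] A)) hD hA hψ hg g d

theorem IsGradedSimple.of_gradedIso {ℬ : ZMod 2 → Submodule F A}
    (h : GradedIso ℬ 𝒟) (hs : IsGradedSimple 𝒟) : IsGradedSimple ℬ := by
  obtain ⟨φ, hφ, hg⟩ := h
  obtain ⟨⟨a, b, hab⟩, hI⟩ := hs
  refine ⟨?_, fun I hid hgr => ?_⟩
  · obtain ⟨a, rfl⟩ := hφ.2 a
    obtain ⟨b, rfl⟩ := hφ.2 b
    exact ⟨a, b, fun h => hab (by rw [← map_mul, h, map_zero])⟩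
  · have hmap : IsIdeal (I.map (φ : A →ₗ[F] D)) := by
      rintro d _ ⟨x, hx, rfl⟩
      obtain ⟨a, rfl⟩ := hφ.2 d
      exact ⟨⟨a * x, (hid a x hx).1, map_mul φ a x⟩, ⟨x * a, (hid a x hx).2, map_mul φ x a⟩⟩
    have hgrd : IsGradedSubspace 𝒟 (I.map (φ : A →ₗ[F] D)) := by
      refine le_antisymm ?_ (iSup_le fun g => inf_le_left)
      conv_lhs => rw [hgr]
      rw [Submodule.map_iSup]
      refine iSup_mono fun g => ?_
      rintro _ ⟨x, ⟨hx, hxg⟩, rfl⟩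
      exact ⟨⟨x, hx, rfl⟩, (hg g x).1 hxg⟩
    rcases hI _ hmap hgrd with h | h
    · left
      refine (Submodule.eq_bot_iff _).2 fun x hx => (map_eq_zero_iff φ hφ.1).1 ?_
      exact (Submodule.mem_bot F).1 (h ▸ Submodule.mem_map_of_mem (f := (φ : A →ₗ[F] D)) hx)
    · right
      refine eq_top_iff.2 fun x _ => ?_
      obtain ⟨y, hy, hyx⟩ : φ x ∈ I.map (φ : A →ₗ[F] D) := h ▸ Submodule.mem_top
      exact hφ.1 hyx ▸ hy

end Transport

end GradedAlg

/-! ### Frames of idempotents and the graded Jacobson radical -/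

namespace GradedAlg

variable {F : Type u} [Field F] {A : Type v} [NonUnitalRing A] [Module F A]
  {𝒜 : ZMod 2 → Submodule F A}

namespace IsGrading

variable (h𝒜 : IsGrading 𝒜)
include h𝒜

theorem isCompl : IsCompl (𝒜 0) (𝒜 1) := isInternal_zmod_two.1 h𝒜.isInternal

theorem mul_mem_zero_zero {a b : A} (ha : a ∈ 𝒜 0) (hb : b ∈ 𝒜 0) : a * b ∈ 𝒜 0 :=
  h𝒜.mul_mem ha hb

theorem mul_mem_zero_one {a b : A} (ha : a ∈ 𝒜 0) (hb : b ∈ 𝒜 1) : a * b ∈ 𝒜 1 := by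
  simpa using h𝒜.mul_mem ha hb

theorem mul_mem_one_zero {a b : A} (ha : a ∈ 𝒜 1) (hb : b ∈ 𝒜 0) : a * b ∈ 𝒜 1 := by
  simpa using h𝒜.mul_mem ha hb

theorem mul_mem_one_one {a b : A} (ha : a ∈ 𝒜 1) (hb : b ∈ 𝒜 1) : a * b ∈ 𝒜 0 :=
  h𝒜.mul_mem ha hb

/-- The component of degree `0` as a subalgebra. -/
def evenPart : NonUnitalSubalgebra F A where
  carrier := 𝒜 0
  add_mem' := (𝒜 0).add_mem
  zero_mem' := (𝒜 0).zero_mem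
  mul_mem' := h𝒜.mul_mem_zero_zero
  smul_mem' c _ := (𝒜 0).smul_mem c

end IsGrading

/-- A frame of orthogonal idempotents of degree `0` spanning the component of degree `0`, which
is moreover assumed to be reduced. -/
structure IsFrame (𝒜 : ZMod 2 → Submodule F A) {ι : Type v} [Fintype ι] (e : ι → A) : Prop where
  mem : ∀ i, e i ∈ 𝒜 0
  ne_zero : ∀ i, e i ≠ 0
  idem : ∀ i, e i * e i = e i
  orth : ∀ i j, i ≠ j → e i * e j = 0
  scalar : ∀ i, ∀ a ∈ 𝒜 0, ∃ c : F, e i * a = c • e i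
  comm : ∀ i, ∀ a ∈ 𝒜 0, e i * a = a * e i
  sum_mul : ∀ a ∈ 𝒜 0, (∑ i, e i) * a = a
  reduced : ∀ a ∈ 𝒜 0, a * a = 0 → a = 0

theorem IsGrading.exists_isFrame [IsScalarTower F A A] [SMulCommClass F A A] [Finite F]
    [FiniteDimensional F A] (h𝒜 : IsGrading 𝒜) (hpow : ∀ y ∈ 𝒜 0, posPow y (Nat.card F) = y) :
    ∃ (ι : Type v) (_ : Fintype ι) (e : ι → A), IsFrame 𝒜 e := by
  have : Fintype F := Fintype.ofFinite F
  have : Finite A := Module.finite_of_finite F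
  obtain ⟨n, hn⟩ : ∃ n, Fintype.card F = n + 2 :=
    ⟨_, (Nat.sub_add_cancel (Fintype.one_lt_card (α := F))).symm⟩
  have hS : ∀ y ∈ h𝒜.evenPart, posPow y (n + 2) = y := by
    rw [Nat.card_eq_fintype_card, hn] at hpow
    exact hpow
  obtain ⟨ι, _, e, h1, h2, h3, h4, h5, h6, h7⟩ := exists_orthogonal_idempotents hS hn
  exact ⟨ι, _, e, h1, h2, h3, h4, h5, h6, h7, fun a ha => eq_zero_of_mul_self hS ha⟩

/-- The elements of degree `1` that annihilate the component of degree `1`. -/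
def oddRadical [IsScalarTower F A A] (𝒜 : ZMod 2 → Submodule F A) : Submodule F A where
  carrier := {x | x ∈ 𝒜 1 ∧ ∀ y ∈ 𝒜 1, x * y = 0}
  zero_mem' := ⟨(𝒜 1).zero_mem, fun _ _ => zero_mul _⟩
  add_mem' := fun ha hb => ⟨add_mem ha.1 hb.1, fun y hy => by
    rw [add_mul, ha.2 y hy, hb.2 y hy, add_zero]⟩
  smul_mem' := fun c _ ha => ⟨Submodule.smul_mem _ c ha.1, fun y hy => by
    rw [smul_mul_assoc, ha.2 y hy, smul_zero]⟩

/-- For `J = oddRadical 𝒜`, the span `M J` is a graded submodule. If it is all of `M`, then `M J = M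
J J = 0` because `J J = 0`; so `J` kills `M` in either case. -/
theorem oddRadical_le_gradedJacobson [IsScalarTower F A A] (hJ : IsIdeal (oddRadical 𝒜)) :
    oddRadical 𝒜 ≤ gradedJacobson 𝒜 := by
  intro x hx M _ _ ρ ℳ hM m
  let N : Submodule F M := Submodule.span F {n | ∃ x ∈ oddRadical 𝒜, ∃ m, n = ρ x m}
  have hN : ∀ x ∈ oddRadical 𝒜, ∀ m, ρ x m ∈ N :=
    fun x hx m => Submodule.subset_span ⟨x, hx, m, rfl⟩
  have hsub : ∀ a : A, ∀ n ∈ N, ρ a n ∈ N := by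
    intro a
    change N ≤ N.comap (ρ a)
    refine Submodule.span_le.2 ?_
    rintro _ ⟨x, hx, m, rfl⟩
    change ρ a (ρ x m) ∈ N
    rw [← hM.act_mul]
    exact hN _ (hJ a x hx).2 m
  have hgr : IsGradedSubspace ℳ N := by
    refine le_antisymm (Submodule.span_le.2 ?_) (iSup_le fun g => inf_le_left)
    rintro _ ⟨x, hx, m, rfl⟩
    obtain ⟨a, ha, b, hb, rfl⟩ := exists_add_of_isCompl (isInternal_zmod_two.1 hM.isInternal) m
    rw [map_add]
    exact add_mem (Submodule.mem_iSup_of_mem _ ⟨hN x hx a, hM.act_mem ha hx.1⟩)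
      (Submodule.mem_iSup_of_mem _ ⟨hN x hx b, hM.act_mem hb hx.1⟩)
  rcases hM.eq_bot_or_top N hsub hgr with h | h
  · exact (Submodule.mem_bot F).1 (h ▸ hN x hx m)
  · have hker : N ≤ LinearMap.ker (ρ x) := by
      refine Submodule.span_le.2 ?_
      rintro _ ⟨z, hz, m, rfl⟩
      change ρ x (ρ z m) = 0
      rw [← hM.act_mul, hz.2 x hx.1, map_zero, LinearMap.zero_apply]
    exact hker (h ▸ Submodule.mem_top)

namespace IsFrame

variable [IsScalarTower F A A] {ι : Type v} [Fintype ι] {e : ι → A}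
  (h𝒜 : IsGrading 𝒜) (he : IsFrame 𝒜 e)
include h𝒜 he

/-- The one-sided condition in `oddRadical` is in fact two-sided: `(y x)² = y (x y) x = 0` and `A₀`
is reduced. -/
theorem mul_oddRadical {x y : A} (hx : x ∈ oddRadical 𝒜) (hy : y ∈ 𝒜 1) : y * x = 0 := by
  refine he.reduced _ (h𝒜.mul_mem_one_one hy hx.1) ?_
  rw [mul_assoc, ← mul_assoc x, hx.2 y hy, zero_mul, mul_zero]

theorem oddRadical_isIdeal : IsIdeal (oddRadical 𝒜) := by
  intro a x hx
  obtain ⟨a₀, h0, a₁, h1, rfl⟩ := exists_add_of_isCompl h𝒜.isCompl a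
  refine ⟨?_, ?_⟩
  · rw [add_mul, he.mul_oddRadical h𝒜 hx h1, add_zero]
    exact ⟨h𝒜.mul_mem_zero_one h0 hx.1, fun y hy => by rw [mul_assoc, hx.2 y hy, mul_zero]⟩
  · rw [mul_add, hx.2 a₁ h1, add_zero]
    exact ⟨h𝒜.mul_mem_one_zero hx.1 h0, fun y hy => by
      rw [mul_assoc, hx.2 _ (h𝒜.mul_mem_zero_one h0 hy)]⟩

/-- The sum `∑ e i` need not act as the identity on `A₁`, but it does on the products `a * y`, which
lie in `A₀`. -/
theorem mem_oddRadical_of_sum_mul {a : A} (ha : a ∈ 𝒜 1) (h : (∑ i, e i) * a ∈ oddRadical 𝒜) :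
    a ∈ oddRadical 𝒜 :=
  ⟨ha, fun y hy => by
    rw [← he.sum_mul _ (h𝒜.mul_mem_one_one ha hy), ← mul_assoc, h.2 y hy]⟩

variable [SMulCommClass F A A]

/-- The quotient of `A` by the right ideal of all `x` with `e i * x ∈ oddRadical 𝒜` is a graded
simple module. -/
theorem mul_mem_oddRadical_of_mem_gradedJacobson (i : ι) {a : A}
    (ha : a ∈ gradedJacobson 𝒜) : e i * a ∈ oddRadical 𝒜 := by
  let I : Submodule F A := (oddRadical 𝒜).comap (LinearMap.mulLeft F (e i))
  have hI : ∀ x, x ∈ I ↔ e i * x ∈ oddRadical 𝒜 := fun x => Iff.rfl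
  have hJ := he.oddRadical_isIdeal h𝒜
  have hIr : ∀ a : A, I ≤ I.comap (LinearMap.mulRight F a) := fun a x hx => by
    change e i * (x * a) ∈ oddRadical 𝒜
    rw [← mul_assoc]
    exact (hJ a _ hx).2
  let ρ : A →ₗ[F] (A ⧸ I) →ₗ[F] (A ⧸ I) :=
    { toFun := fun a => I.mapQ I (LinearMap.mulRight F a) (hIr a)
      map_add' := fun a b => by
        ext x
        simp [mul_add]
      map_smul' := fun c a => by
        ext x
        exact congrArg I.mkQ (mul_smul_comm c x a) }
  have hρ : ∀ a x, ρ a (I.mkQ x) = I.mkQ (x * a) := fun a x => rfl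
  let ℳ : ZMod 2 → Submodule F (A ⧸ I) := fun g => (𝒜 g).map I.mkQ
  have hcompl : IsCompl (ℳ 0) (ℳ 1) := by
    refine ⟨Submodule.disjoint_def.2 ?_, codisjoint_iff.2 (eq_top_iff.2 fun x _ => ?_)⟩
    · rintro _ ⟨x, hx, rfl⟩ ⟨y, hy, hxy⟩
      have h1 : e i * (y - x) ∈ oddRadical 𝒜 := (Submodule.Quotient.eq I).1 hxy
      have h2 : e i * x ∈ 𝒜 1 := by
        rw [mul_sub] at h1
        exact (Submodule.sub_mem_iff_right _ (h𝒜.mul_mem_zero_one (he.mem i) hy)).1 h1.1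
      have h3 := eq_zero_of_mem_both h𝒜.isCompl (h𝒜.mul_mem_zero_zero (he.mem i) hx) h2
      refine (Submodule.Quotient.mk_eq_zero I).2 ?_
      rw [hI, h3]
      exact zero_mem _
    · obtain ⟨x, rfl⟩ := I.mkQ_surjective x
      obtain ⟨a, ha, b, hb, rfl⟩ := exists_add_of_isCompl h𝒜.isCompl x
      rw [map_add]
      exact Submodule.add_mem_sup ⟨a, ha, rfl⟩ ⟨b, hb, rfl⟩
  -- A degree `0` class outside `I` generates the quotient: `x * e i = c • e i` with `c ≠ 0`
  -- recovers `e i`, and `y` is congruent to `e i * y` modulo `I`.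
  have hgen : ∀ N : Submodule F (A ⧸ I), (∀ a : A, ∀ m ∈ N, ρ a m ∈ N) → ∀ x ∈ 𝒜 0,
      I.mkQ x ∈ N → e i * x ≠ 0 → N = ⊤ := by
    intro N hN x hx hxN hx0
    obtain ⟨c, hc⟩ := he.scalar i x hx
    have hc0 : c ≠ 0 := by
      rintro rfl
      rw [zero_smul] at hc
      exact hx0 hc
    refine eq_top_iff.2 fun y _ => ?_
    obtain ⟨y, rfl⟩ := I.mkQ_surjective y
    have : I.mkQ y = ρ (c⁻¹ • y) (ρ (e i) (I.mkQ x)) := by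
      rw [hρ, hρ]
      refine (Submodule.Quotient.eq I).2 ?_
      rw [hI, ← he.comm i x hx, hc, smul_mul_smul_comm, mul_inv_cancel₀ hc0, one_smul, mul_sub,
        ← mul_assoc, he.idem, sub_self]
      exact zero_mem _
    rw [this]
    exact hN _ _ (hN _ _ hxN)
  have hM : IsGradedSimpleRightModule 𝒜 ρ ℳ :=
    { act_mul := fun a b m => by
        obtain ⟨m, rfl⟩ := I.mkQ_surjective m
        rw [hρ, hρ, hρ, mul_assoc]
      isInternal := isInternal_zmod_two.2 hcompl
      act_mem := by
        rintro g h a _ ⟨m, hm, rfl⟩ ha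
        exact ⟨m * a, h𝒜.mul_mem hm ha, rfl⟩
      act_ne_zero := by
        refine ⟨e i, I.mkQ (e i), fun h => he.ne_zero i ?_⟩
        rw [hρ, he.idem] at h
        have h1 := (Submodule.Quotient.mk_eq_zero I).1 h
        rw [hI, he.idem] at h1
        exact eq_zero_of_mem_both h𝒜.isCompl (he.mem i) h1.1
      eq_bot_or_top := by
        intro N hN hgr
        rw [or_iff_not_imp_left]
        intro hne
        obtain ⟨g, _, hv, ⟨x, hx, rfl⟩, hv0⟩ := hgr.exists_ne_zero hne
        have hxI : e i * x ∉ oddRadical 𝒜 := fun h =>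
          hv0 ((Submodule.Quotient.mk_eq_zero I).2 h)
        rcases zmod_two_cases g with rfl | rfl
        · exact hgen N hN x hx hv fun h => hxI (h ▸ zero_mem _)
        · have hx1 : e i * x ∈ 𝒜 1 := h𝒜.mul_mem_zero_one (he.mem i) hx
          -- An odd class outside `I` is moved to degree `0` by an odd `y` that witnesses `e i * x ∉
          -- oddRadical 𝒜`.
          obtain ⟨y, hy, hxy⟩ : ∃ y ∈ 𝒜 1, e i * x * y ≠ 0 := by
            by_contra! hc
            exact hxI ⟨hx1, hc⟩
          refine hgen N hN (x * y) (h𝒜.mul_mem_one_one hx hy) (hN y _ hv) ?_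
          rwa [← mul_assoc] }
  have h1 := ha (A ⧸ I) ρ ℳ hM (I.mkQ (e i))
  rw [hρ] at h1
  have h2 := (Submodule.Quotient.mk_eq_zero I).1 h1
  rwa [hI, ← mul_assoc, he.idem] at h2

theorem gradedJacobson_eq_oddRadical : gradedJacobson 𝒜 = oddRadical 𝒜 := by
  refine le_antisymm (fun a ha => ?_)
    (oddRadical_le_gradedJacobson (he.oddRadical_isIdeal h𝒜))
  have hsum : (∑ i, e i) * a ∈ oddRadical 𝒜 := by
    rw [Finset.sum_mul]
    exact sum_mem fun i _ => he.mul_mem_oddRadical_of_mem_gradedJacobson h𝒜 i ha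
  obtain ⟨a₀, h0, a₁, h1, rfl⟩ := exists_add_of_isCompl h𝒜.isCompl a
  have hs : ∑ i, e i ∈ 𝒜 0 := sum_mem fun i _ => he.mem i
  have ha0 : a₀ = 0 := by
    rw [mul_add, he.sum_mul a₀ h0] at hsum
    exact eq_zero_of_mem_both h𝒜.isCompl h0
      ((Submodule.add_mem_iff_left _ (h𝒜.mul_mem_zero_one hs h1)).1 hsum.1)
  subst ha0
  rw [zero_add] at hsum ⊢
  exact he.mem_oddRadical_of_sum_mul h𝒜 h1 hsum

end IsFrame

end GradedAlg

/-! ### Linked idempotents and the blocks they carry -/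

namespace GradedAlg

variable {F : Type u} [Field F] {A : Type v} [NonUnitalRing A] [Module F A]
  {𝒜 : ZMod 2 → Submodule F A} [IsScalarTower F A A]

/-- `C` is a graded simple subalgebra with identity `f`, isomorphic to one of the three models,
and it contains `f * A` modulo the radical. -/
structure IsBlock (𝒜 : ZMod 2 → Submodule F A) (f : A) (C : NonUnitalSubalgebra F A) : Prop where
  graded : IsGradedSubspace 𝒜 C.toSubmodule
  simple : IsGradedSimple (inducedGrading 𝒜 C)
  model : GradedIso (inducedGrading 𝒜 C) (fieldGrading F) ∨
    GradedIso (inducedGrading 𝒜 C) (groupAlgebraGrading F) ∨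
    GradedIso (inducedGrading 𝒜 C) (matrixGrading F)
  unit_mul : ∀ c ∈ C, f * c = c
  mul_unit : ∀ c ∈ C, c * f = c
  inf_radical : ∀ c ∈ C, c ∈ oddRadical 𝒜 → c = 0
  even_mem : ∀ a ∈ 𝒜 0, f * a ∈ C
  odd_mem : ∀ a ∈ 𝒜 1, f * a ∈ C.toSubmodule ⊔ oddRadical 𝒜

omit [IsScalarTower F A A] in
theorem gradedHom_injective {D : Type w} [NonUnitalRing D] [Module F D]
    {𝒟 : ZMod 2 → Submodule F D} (hA : IsCompl (𝒜 0) (𝒜 1)) (hD : IsCompl (𝒟 0) (𝒟 1))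
    (hs : IsGradedSimple 𝒟) (ψ : D →ₙₐ[F] A) (hg : ∀ g, ∀ v ∈ 𝒟 g, ψ v ∈ 𝒜 g)
    {u : D} (hu : ψ u ≠ 0) : Function.Injective ψ := by
  have hker : ∀ d, d ∈ LinearMap.ker (ψ : D →ₗ[F] A) ↔ ψ d = 0 := fun d => Iff.rfl
  have hid : IsIdeal (LinearMap.ker (ψ : D →ₗ[F] A)) := fun a x hx => by
    rw [hker] at hx
    rw [hker, hker, map_mul, map_mul, hx, mul_zero, zero_mul]
    exact ⟨rfl, rfl⟩
  have hgr : IsGradedSubspace 𝒟 (LinearMap.ker (ψ : D →ₗ[F] A)) := by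
    refine isGradedSubspace_of_forall fun d hd => ?_
    obtain ⟨a, ha, b, hb, rfl⟩ := exists_add_of_isCompl hD d
    rw [hker, map_add] at hd
    have h0 : ψ a = 0 := by
      refine eq_zero_of_mem_both hA (hg 0 a ha) ?_
      rw [eq_neg_of_add_eq_zero_left hd]
      exact neg_mem (hg 1 b hb)
    rw [h0, zero_add] at hd
    exact ⟨a, ⟨h0, ha⟩, b, ⟨hd, hb⟩, rfl⟩
  rcases hs.2 _ hid hgr with h | h
  · exact LinearMap.ker_eq_bot.1 h
  · have : u ∈ LinearMap.ker (ψ : D →ₗ[F] A) := h ▸ Submodule.mem_top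
    exact absurd this hu

/-- This reduces each type of block to a graded homomorphism from its model; injectivity comes from
graded simplicity. -/
theorem IsBlock.of_model {D : Type w} [Ring D] [Module F D]
    {𝒟 : ZMod 2 → Submodule F D} (hA : IsCompl (𝒜 0) (𝒜 1)) (hJ : IsIdeal (oddRadical 𝒜))
    (hD : IsCompl (𝒟 0) (𝒟 1)) (hs : IsGradedSimple 𝒟) (ψ : D →ₙₐ[F] A)
    (hg : ∀ g, ∀ v ∈ 𝒟 g, ψ v ∈ 𝒜 g) {f : A} (hf : ψ 1 = f) (hf0 : f ≠ 0) (hfA : f ∈ 𝒜 0)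
    (hmodel : ∀ C : NonUnitalSubalgebra F A, GradedIso (inducedGrading 𝒜 C) 𝒟 →
      GradedIso (inducedGrading 𝒜 C) (fieldGrading F) ∨
      GradedIso (inducedGrading 𝒜 C) (groupAlgebraGrading F) ∨
      GradedIso (inducedGrading 𝒜 C) (matrixGrading F))
    (heven : ∀ a ∈ 𝒜 0, ∃ d, ψ d = f * a)
    (hodd : ∀ a ∈ 𝒜 1, ∃ d, f * a - ψ d ∈ oddRadical 𝒜) :
    IsBlock 𝒜 f (NonUnitalAlgHom.range ψ) := by
  have hψ := gradedHom_injective hA hD hs ψ hg (hf ▸ hf0)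
  have hiso := range_gradedIso ψ hA hD hψ hg
  have hmem : ∀ d, d ∈ (oddRadical 𝒜).comap (ψ : D →ₗ[F] A) ↔ ψ d ∈ oddRadical 𝒜 :=
    fun d => Iff.rfl
  -- The preimage of the radical is an ideal concentrated in degree `1`, hence graded. It misses
  -- `1`, whose image `f` is even and nonzero, so it is zero.
  have hbot : (oddRadical 𝒜).comap (ψ : D →ₗ[F] A) = ⊥ := by
    refine (hs.2 _ (fun a x hx => ?_) (isGradedSubspace_of_le 1 fun d hd => ?_)).resolve_right
      fun h => ?_
    · rw [hmem] at hx
      rw [hmem, hmem, map_mul, map_mul]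
      exact hJ _ _ hx
    · exact (mem_iff_of_map (ψ := (ψ : D →ₗ[F] A)) hD hA hψ hg 1 d).1 hd.1
    · have : (1 : D) ∈ (oddRadical 𝒜).comap (ψ : D →ₗ[F] A) := h ▸ Submodule.mem_top
      rw [hmem, hf] at this
      exact hf0 (eq_zero_of_mem_both hA hfA this.1)
  refine ⟨range_isGradedSubspace ψ hD hg, hs.of_gradedIso hiso, hmodel _ hiso, ?_, ?_, ?_, ?_, ?_⟩
  · rintro _ ⟨d, rfl⟩
    change f * ψ d = ψ d
    rw [← hf, ← map_mul, one_mul]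
  · rintro _ ⟨d, rfl⟩
    change ψ d * f = ψ d
    rw [← hf, ← map_mul, mul_one]
  · rintro _ ⟨d, rfl⟩ hd
    have : d ∈ (oddRadical 𝒜).comap (ψ : D →ₗ[F] A) := hd
    rw [hbot, Submodule.mem_bot] at this
    rw [this]
    exact map_zero ψ
  · intro a ha
    obtain ⟨d, hd⟩ := heven a ha
    exact ⟨d, hd⟩
  · intro a ha
    obtain ⟨d, hd⟩ := hodd a ha
    exact Submodule.mem_sup.2 ⟨ψ d, ⟨d, rfl⟩, _, hd, add_sub_cancel _ _⟩

/-- Two idempotents of a frame are linked if they are the diagonal of a system of matrix units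
whose other elements have degree `1`. -/
def Linked (𝒜 : ZMod 2 → Submodule F A) {ι : Type v} (e : ι → A) (i j : ι) : Prop :=
  ∃ x ∈ 𝒜 1, ∃ y ∈ 𝒜 1, e i * x = x ∧ x * e j = x ∧ e j * y = y ∧ y * e i = y ∧
    x * y = e i ∧ y * x = e j

omit [IsScalarTower F A A] in
theorem Linked.symm {ι : Type v} {e : ι → A} {i j : ι} (h : Linked 𝒜 e i j) : Linked 𝒜 e j i := by
  obtain ⟨x, hx, y, hy, h1, h2, h3, h4, h5, h6⟩ := h
  exact ⟨y, hy, x, hx, h3, h4, h1, h2, h6, h5⟩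

namespace IsFrame

variable {ι : Type v} [Fintype ι] {e : ι → A} (h𝒜 : IsGrading 𝒜) (he : IsFrame 𝒜 e)
include h𝒜 he

omit [IsScalarTower F A A] in
-- If `x, y` link `i` to `j` and `z, w` link `i` to `k`, then `e i = (z w)(x y)`. The inner product
-- `w x` lies in `e k * A₀ * e j`, which is zero for `j ≠ k`.
theorem linked_unique {i j k : ι} (hj : Linked 𝒜 e i j) (hk : Linked 𝒜 e i k) : j = k := by
  obtain ⟨x, hx, y, hy, h1, h2, h3, h4, h5, h6⟩ := hj
  obtain ⟨z, hz, w, hw, g1, g2, g3, g4, g5, g6⟩ := hk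
  by_contra hne
  apply he.ne_zero i
  have hwx : w * x = 0 := by
    rw [← h2, ← mul_assoc, ← g3, mul_assoc (e k), he.comm k _ (h𝒜.mul_mem_one_one hw hx),
      mul_assoc, he.orth k j (Ne.symm hne), mul_zero]
  rw [← he.idem i, ← g5]
  nth_rewrite 2 [g5]
  rw [← h5, mul_assoc, ← mul_assoc w, hwx, zero_mul, mul_zero]

variable [SMulCommClass F A A]

/-- Modulo the radical, `e i * A₁` is the line through `x`. With `c` read off from `e i * a * y = c
• e i`, the difference `w` satisfies `w y = 0`. For odd `z`, `z x = d • e j`, so `w z = w z e i = w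
(z x) y = d • (w y) = 0`. -/
theorem exists_sub_smul_mem {i j : ι} {x y a : A} (hx : x ∈ 𝒜 1) (hy : y ∈ 𝒜 1) (ha : a ∈ 𝒜 1)
    (h1 : e i * x = x) (h2 : x * e j = x) (h3 : e j * y = y) (h5 : x * y = e i) :
    ∃ c : F, e i * a - c • x ∈ oddRadical 𝒜 := by
  obtain ⟨c, hc⟩ := he.scalar i (a * y) (h𝒜.mul_mem_one_one ha hy)
  have hw : e i * a - c • x ∈ 𝒜 1 :=
    sub_mem (h𝒜.mul_mem_zero_one (he.mem i) ha) (Submodule.smul_mem _ c hx)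
  have hwi : e i * (e i * a - c • x) = e i * a - c • x := by
    rw [mul_sub, ← mul_assoc, he.idem, mul_smul_comm, h1]
  have hwy : (e i * a - c • x) * y = 0 := by
    rw [sub_mul, mul_assoc, hc, smul_mul_assoc, h5, sub_self]
  refine ⟨c, hw, fun z hz => ?_⟩
  generalize e i * a - c • x = w at *
  have hzx := h𝒜.mul_mem_one_one hz hx
  obtain ⟨d, hd⟩ := he.scalar j (z * x) hzx
  rw [he.comm j _ hzx, mul_assoc, h2] at hd
  rw [← hwi, mul_assoc, he.comm i _ (h𝒜.mul_mem_one_one hw hz), ← h5, mul_assoc, ← mul_assoc z,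
    hd, smul_mul_assoc, h3, mul_smul_comm, hwy, smul_zero]

omit [SMulCommClass F A A] in
theorem mul_sum_mul {a z : A} (ha : a ∈ 𝒜 1) (hz : z ∈ 𝒜 1) : a * ((∑ j, e j) * z) = a * z := by
  have hs : ∑ i, e i ∈ 𝒜 0 := sum_mem fun i _ => he.mem i
  have hw : z - (∑ j, e j) * z ∈ oddRadical 𝒜 := by
    refine he.mem_oddRadical_of_sum_mul h𝒜 (sub_mem hz (h𝒜.mul_mem_zero_one hs hz)) ?_
    rw [mul_sub, ← mul_assoc, he.sum_mul _ hs, sub_self]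
    exact zero_mem _
  have := he.mul_oddRadical h𝒜 hw ha
  rw [mul_sub] at this
  exact (sub_eq_zero.1 this).symm

/-- If `e i * a * z ≠ 0` for some odd `z`, then some `e i * a * e j * z` is nonzero. Multiplied on
the right by `e i`, it is a nonzero multiple of `e i`, so rescaling `e i * a * e j` and pairing it
with `e j * z * e i` links `i` to `j`. -/
theorem mul_mem_oddRadical_of_not_linked {i : ι} (h : ∀ j, ¬ Linked 𝒜 e i j) {a : A}
    (ha : a ∈ 𝒜 1) : e i * a ∈ oddRadical 𝒜 := by
  have hia := h𝒜.mul_mem_zero_one (he.mem i) ha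
  refine ⟨hia, fun z hz => ?_⟩
  rw [← he.mul_sum_mul h𝒜 hia hz, Finset.sum_mul, Finset.mul_sum]
  refine Finset.sum_eq_zero fun j _ => ?_
  by_contra hne
  apply h j
  obtain ⟨c, hc⟩ := he.scalar i (a * (e j * z))
    (h𝒜.mul_mem_one_one ha (h𝒜.mul_mem_zero_one (he.mem j) hz))
  rw [← mul_assoc] at hc
  have hc0 : c ≠ 0 := by
    rintro rfl
    rw [zero_smul] at hc
    exact hne hc
  have hx : c⁻¹ • (e i * a * e j) ∈ 𝒜 1 :=
    Submodule.smul_mem _ _ (h𝒜.mul_mem_one_zero hia (he.mem j))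
  have hy : e j * z * e i ∈ 𝒜 1 :=
    h𝒜.mul_mem_one_zero (h𝒜.mul_mem_zero_one (he.mem j) hz) (he.mem i)
  have h1 : e i * (c⁻¹ • (e i * a * e j)) = c⁻¹ • (e i * a * e j) := by
    rw [mul_smul_comm, ← mul_assoc, ← mul_assoc, he.idem]
  have h2 : (c⁻¹ • (e i * a * e j)) * e j = c⁻¹ • (e i * a * e j) := by
    rw [smul_mul_assoc, mul_assoc, he.idem]
  have h3 : e j * (e j * z * e i) = e j * z * e i := by
    rw [← mul_assoc, ← mul_assoc, he.idem]
  have h4 : (e j * z * e i) * e i = e j * z * e i := by rw [mul_assoc, he.idem]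
  have h5 : (c⁻¹ • (e i * a * e j)) * (e j * z * e i) = e i := by
    rw [smul_mul_assoc, mul_assoc (e i * a), h3, ← mul_assoc, hc, smul_mul_assoc, he.idem,
      smul_smul, inv_mul_cancel₀ hc0, one_smul]
  generalize c⁻¹ • (e i * a * e j) = x at *
  generalize e j * z * e i = y at *
  refine ⟨x, hx, y, hy, h1, h2, h3, h4, h5, ?_⟩
  obtain ⟨d, hd⟩ := he.scalar j (y * x) (h𝒜.mul_mem_one_one hy hx)
  rw [← mul_assoc, h3] at hd
  have hx0 : x ≠ 0 := by
    rintro rfl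
    rw [zero_mul] at h5
    exact he.ne_zero i h5.symm
  -- From `x = (x y) x = x (y x) = d • x`.
  have hdx : (1 - d) • x = 0 := by
    rw [sub_smul, one_smul, sub_eq_zero]
    nth_rewrite 1 [← h1]
    rw [← h5, mul_assoc, hd, mul_smul_comm, h2]
  rw [hd, ← sub_eq_zero.1 ((smul_eq_zero.1 hdx).resolve_right hx0), one_smul]

theorem exists_block_field {i : ι} (h : ∀ j, ¬ Linked 𝒜 e i j) :
    ∃ C, IsBlock 𝒜 (e i) C := by
  let ψ : F →ₙₐ[F] A :=
    { toFun := fun c => c • e i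
      map_smul' := fun c d => by simp [mul_smul]
      map_zero' := by simp
      map_add' := fun c d => add_smul c d _
      map_mul' := fun c d => by rw [smul_mul_smul_comm, he.idem] }
  refine ⟨_, IsBlock.of_model h𝒜.isCompl (he.oddRadical_isIdeal h𝒜) (fieldGrading_isCompl F)
    (fieldGrading_isGradedSimple F) ψ ?_ (one_smul F (e i)) (he.ne_zero i) (he.mem i)
    (fun C hC => Or.inl hC) (fun a ha => ?_) (fun a ha => ⟨0, ?_⟩)⟩
  · intro g v hv
    rcases zmod_two_cases g with rfl | rfl
    · exact Submodule.smul_mem _ v (he.mem i)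
    · have hv : v = 0 := by
        have h' : fieldGrading F 1 = ⊥ := if_neg one_ne_zero
        rwa [h', Submodule.mem_bot] at hv
      rw [hv, map_zero]
      exact zero_mem _
  · obtain ⟨c, hc⟩ := he.scalar i a ha
    exact ⟨c, hc.symm⟩
  · rw [map_zero, sub_zero]
    exact he.mul_mem_oddRadical_of_not_linked h𝒜 h ha

theorem exists_block_groupAlgebra [Finite F] [CharP F 2] {i : ι} (h : Linked 𝒜 e i i) :
    ∃ C, IsBlock 𝒜 (e i) C := by
  obtain ⟨x, hx, hix, hxi, hxx⟩ : ∃ x ∈ 𝒜 1, e i * x = x ∧ x * e i = x ∧ x * x = e i := by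
    obtain ⟨x, hx, y, hy, h1, h2, h3, h4, h5, h6⟩ := h
    obtain ⟨c, hc⟩ := he.scalar i (x * x) (h𝒜.mul_mem_one_one hx hx)
    rw [← mul_assoc, h1] at hc
    have hc0 : c ≠ 0 := by
      rintro rfl
      apply he.ne_zero i
      rw [zero_smul] at hc
      -- If `x * x = 0`, then `e i = x y = x (e i) y = x x y y = 0`.
      rw [← h5, ← h3, ← h5, mul_assoc, ← mul_assoc, hc, zero_mul]
    -- Every element of a finite field of characteristic `2` is a square, so `x` can be rescaled to
    -- have square `e i`.
    obtain ⟨s, rfl⟩ := FiniteField.isSquare_of_char_two (ringChar.eq F 2) c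
    refine ⟨s⁻¹ • x, Submodule.smul_mem _ _ hx, by rw [mul_smul_comm, h1],
      by rw [smul_mul_assoc, h2], ?_⟩
    rw [smul_mul_smul_comm, hc, smul_smul, ← mul_inv, inv_mul_cancel₀ hc0, one_smul]
  let θ : Multiplicative (ZMod 2) →ₙ* A :=
    { toFun := fun g => if g.toAdd = 0 then e i else x
      map_mul' := fun g h => by
        rcases zmod_two_cases g.toAdd with hg | hg <;> rcases zmod_two_cases h.toAdd with hh | hh <;>
          simp [hg, hh, he.idem, hix, hxi, hxx, CharTwo.add_self_eq_zero] }
  let ψ : AddMonoidAlgebra F (ZMod 2) →ₙₐ[F] A := AddMonoidAlgebra.liftMagma F θ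
  have hψ0 : ∀ c, ψ (AddMonoidAlgebra.single 0 c) = c • e i := fun c => by
    simp [ψ, θ, AddMonoidAlgebra.liftMagma_apply_apply]
  have hψ1 : ∀ c, ψ (AddMonoidAlgebra.single 1 c) = c • x := fun c => by
    simp [ψ, θ, AddMonoidAlgebra.liftMagma_apply_apply]
  refine ⟨_, IsBlock.of_model h𝒜.isCompl (he.oddRadical_isIdeal h𝒜) (groupAlgebraGrading_isCompl F)
    (groupAlgebraGrading_isGradedSimple F) ψ ?_ ?_ (he.ne_zero i) (he.mem i)
    (fun C hC => Or.inr (Or.inl hC)) (fun a ha => ?_) (fun a ha => ?_)⟩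
  · intro g v hv
    obtain ⟨c, rfl⟩ := (AddMonoidAlgebra.mem_grade_iff' F g v).1 hv
    rcases zmod_two_cases g with rfl | rfl
    · exact (hψ0 c).symm ▸ Submodule.smul_mem _ c (he.mem i)
    · exact (hψ1 c).symm ▸ Submodule.smul_mem _ c hx
  · rw [AddMonoidAlgebra.one_def, hψ0, one_smul]
  · obtain ⟨c, hc⟩ := he.scalar i a ha
    exact ⟨AddMonoidAlgebra.single 0 c, by rw [hψ0, hc]⟩
  · obtain ⟨c, hc⟩ := he.exists_sub_smul_mem h𝒜 hx hx ha hix hxi hix hxx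
    exact ⟨AddMonoidAlgebra.single 1 c, by rwa [hψ1]⟩

theorem exists_block_matrix {i j : ι} (hij : i ≠ j) (h : Linked 𝒜 e i j) :
    ∃ C, IsBlock 𝒜 (e i + e j) C := by
  obtain ⟨x, hx, y, hy, h1, h2, h3, h4, h5, h6⟩ := h
  have hij0 := he.orth i j hij
  have hji0 := he.orth j i hij.symm
  have hjx : e j * x = 0 := by rw [← h1, ← mul_assoc, hji0, zero_mul]
  have hxi : x * e i = 0 := by rw [← h2, mul_assoc, hji0, mul_zero]
  have hiy : e i * y = 0 := by rw [← h3, ← mul_assoc, hij0, zero_mul]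
  have hyj : y * e j = 0 := by rw [← h4, mul_assoc, hij0, mul_zero]
  have hxx : x * x = 0 := by
    nth_rewrite 2 [← h1]
    rw [← mul_assoc, hxi, zero_mul]
  have hyy : y * y = 0 := by
    nth_rewrite 2 [← h3]
    rw [← mul_assoc, hyj, zero_mul]
  -- The elements `e i, x, y, e j` play the matrix units `E₀₀, E₀₁, E₁₀, E₁₁`.
  let ψ : Matrix (Fin 2) (Fin 2) F →ₙₐ[F] A :=
    { toFun := fun M => M 0 0 • e i + M 0 1 • x + M 1 0 • y + M 1 1 • e j
      map_smul' := fun c M => by simp [mul_smul]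
      map_zero' := by simp
      map_add' := fun M N => by
        simp only [Matrix.add_apply]
        module
      map_mul' := fun M N => by
        simp only [Matrix.mul_apply, Fin.sum_univ_two, add_mul, mul_add, smul_mul_smul_comm,
          he.idem, h1, h2, h3, h4, h5, h6, hij0, hji0, hjx, hxi, hiy, hyj, hxx, hyy, smul_zero]
        module }
  have hψ : ∀ M, ψ M = M 0 0 • e i + M 0 1 • x + M 1 0 • y + M 1 1 • e j := fun M => rfl
  refine ⟨_, IsBlock.of_model h𝒜.isCompl (he.oddRadical_isIdeal h𝒜) (matrixGrading_isCompl F)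
    (matrixGrading_isGradedSimple F) ψ ?_ ?_ ?_ (add_mem (he.mem i) (he.mem j))
    (fun C hC => Or.inr (Or.inr hC)) (fun a ha => ?_) (fun a ha => ?_)⟩
  · intro g M hM
    rcases zmod_two_cases g with rfl | rfl
    · obtain ⟨h01, h10⟩ := hM.2 zero_ne_one
      rw [hψ, h01, h10, zero_smul, zero_smul, add_zero, add_zero]
      exact add_mem (Submodule.smul_mem _ _ (he.mem i)) (Submodule.smul_mem _ _ (he.mem j))
    · obtain ⟨h00, h11⟩ := hM.1 one_ne_zero
      rw [hψ, h00, h11, zero_smul, zero_smul, add_zero, zero_add]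
      exact add_mem (Submodule.smul_mem _ _ hx) (Submodule.smul_mem _ _ hy)
  · simp [hψ]
  · intro h0
    apply he.ne_zero i
    have := congrArg (e i * ·) h0
    simpa [mul_add, he.idem, hij0] using this
  · obtain ⟨c, hc⟩ := he.scalar i a ha
    obtain ⟨d, hd⟩ := he.scalar j a ha
    exact ⟨!![c, 0; 0, d], by simp [hψ, add_mul, hc, hd]⟩
  · obtain ⟨c, hc⟩ := he.exists_sub_smul_mem h𝒜 hx hy ha h1 h2 h3 h5
    obtain ⟨d, hd⟩ := he.exists_sub_smul_mem h𝒜 hy hx ha h3 h4 h1 h6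
    refine ⟨!![0, c; d, 0], ?_⟩
    have := add_mem hc hd
    convert this using 1
    simp only [hψ, add_mul]
    simp
    abel

end IsFrame

end GradedAlg

/-! ### Link classes and the assembly of the complement -/

namespace GradedAlg

variable {F : Type u} [Field F] {A : Type v} [NonUnitalRing A] [Module F A]
  {𝒜 : ZMod 2 → Submodule F A} [IsScalarTower F A A]

namespace IsFrame

variable {ι : Type v} [Fintype ι] {e : ι → A} (h𝒜 : IsGrading 𝒜) (he : IsFrame 𝒜 e)
include h𝒜 he

/-- Linked idempotents are equivalent; by `linked_unique` a class has at most two elements. -/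
def linkedSetoid : Setoid ι where
  r i j := i = j ∨ Linked 𝒜 e i j
  iseqv :=
    { refl := fun _ => Or.inl rfl
      symm := by
        rintro i j (rfl | h)
        · exact Or.inl rfl
        · exact Or.inr h.symm
      trans := by
        rintro i j k (rfl | h) (rfl | h')
        · exact Or.inl rfl
        · exact Or.inr h'
        · exact Or.inr h
        · exact Or.inl (he.linked_unique h𝒜 h.symm h') }

variable [SMulCommClass F A A]

open Classical in
theorem exists_block_sum [Finite F] [CharP F 2] (i : ι) :
    ∃ C, IsBlock 𝒜 (∑ j with i = j ∨ Linked 𝒜 e i j, e j) C := by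
  by_cases h : ∃ j, Linked 𝒜 e i j
  · obtain ⟨j, hj⟩ := h
    have hlink : ∀ k, Linked 𝒜 e i k ↔ j = k :=
      fun k => ⟨fun hk => he.linked_unique h𝒜 hj hk, fun hk => hk ▸ hj⟩
    by_cases hij : i = j
    · subst hij
      simpa [hlink, Finset.filter_eq] using he.exists_block_groupAlgebra h𝒜 hj
    · have : (Finset.univ.filter fun k => i = k ∨ Linked 𝒜 e i k) = {i, j} := by
        ext k
        simp [hlink, eq_comm]
      rw [this, Finset.sum_pair hij]
      exact he.exists_block_matrix h𝒜 hij hj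
  · push Not at h
    simpa [h, Finset.filter_eq] using he.exists_block_field h𝒜 h

theorem exists_blocks [Finite F] [CharP F 2] :
    ∃ (r : ℕ) (f : Fin r → A) (C : Fin r → NonUnitalSubalgebra F A),
      (∀ k l, k ≠ l → f k * f l = 0) ∧ ∑ k, f k = ∑ i, e i ∧ ∀ k, IsBlock 𝒜 (f k) (C k) := by
  classical
  let s := he.linkedSetoid h𝒜
  let f : Quotient s → A := fun k => ∑ i with Quotient.mk s i = k, e i
  have horth : ∀ k l, k ≠ l → f k * f l = 0 := by
    intro k l hkl
    rw [Finset.sum_mul_sum]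
    refine Finset.sum_eq_zero fun i hi => Finset.sum_eq_zero fun j hj => he.orth i j ?_
    rintro rfl
    exact hkl ((Finset.mem_filter.1 hi).2.symm.trans (Finset.mem_filter.1 hj).2)
  have hblock : ∀ k, ∃ C, IsBlock 𝒜 (f k) C := by
    intro k
    obtain ⟨i, rfl⟩ := Quotient.exists_rep k
    obtain ⟨C, hC⟩ := he.exists_block_sum h𝒜 i
    refine ⟨C, ?_⟩
    convert hC using 1
    refine Finset.sum_congr (Finset.filter_congr fun j _ => ?_) fun _ _ => rfl
    rw [eq_comm]
    exact Quotient.eq (r := s)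
  choose C hC using hblock
  let ε := (Fintype.equivFin (Quotient s)).symm
  refine ⟨_, fun k => f (ε k), fun k => C (ε k), fun k l hkl => horth _ _ (ε.injective.ne hkl), ?_,
    fun k => hC _⟩
  rw [Equiv.sum_comp ε f]
  exact Finset.sum_fiberwise _ _ _

end IsFrame

section Assembly

variable {r : ℕ} {f : Fin r → A} {C : Fin r → NonUnitalSubalgebra F A}
  (horth : ∀ k l, k ≠ l → f k * f l = 0) (hC : ∀ k, IsBlock 𝒜 (f k) (C k))
include horth hC

theorem blocks_mul_eq_zero {k l : Fin r} (hkl : k ≠ l) {c d : A} (hc : c ∈ C k) (hd : d ∈ C l) :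
    c * d = 0 := by
  rw [← (hC k).mul_unit c hc, ← (hC l).unit_mul d hd, mul_assoc, ← mul_assoc (f k), horth k l hkl,
    zero_mul, mul_zero]

theorem mul_mem_block {k : Fin r} {b c : A} (hb : b ∈ ⨆ l, (C l).toSubmodule) (hc : c ∈ C k) :
    b * c ∈ C k ∧ c * b ∈ C k := by
  induction hb using Submodule.iSup_induction' with
  | mem l x hx =>
    by_cases h : l = k
    · subst h
      exact ⟨mul_mem hx hc, mul_mem hc hx⟩
    · rw [blocks_mul_eq_zero horth hC h hx hc, blocks_mul_eq_zero horth hC (Ne.symm h) hc hx]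
      exact ⟨zero_mem _, zero_mem _⟩
  | zero => simp
  | add x y _ _ hx hy =>
    rw [add_mul, mul_add]
    exact ⟨add_mem hx.1 hy.1, add_mem hx.2 hy.2⟩

/-- Left multiplication by `f k` fixes `C k` and kills every other block. -/
theorem blocks_iSupIndep [SMulCommClass F A A] : iSupIndep fun k => (C k).toSubmodule := by
  intro k
  refine Submodule.disjoint_def.2 fun x hx hx' => ?_
  have hle : ⨆ l, ⨆ (_ : l ≠ k), (C l).toSubmodule ≤ LinearMap.ker (LinearMap.mulLeft F (f k)) := by
    refine iSup₂_le fun l hl c hc => ?_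
    change f k * c = 0
    rw [← (hC l).unit_mul c hc, ← mul_assoc, horth k l hl.symm, zero_mul]
  rw [← (hC k).unit_mul x hx]
  exact hle hx'

/-- The sum of the blocks as a subalgebra. -/
def blockSum : NonUnitalSubalgebra F A where
  carrier := (⨆ k, (C k).toSubmodule : Submodule F A)
  add_mem' := add_mem
  zero_mem' := zero_mem _
  smul_mem' c _ := Submodule.smul_mem _ c
  mul_mem' := by
    intro a b ha hb
    induction hb using Submodule.iSup_induction' with
    | mem l x hx => exact Submodule.mem_iSup_of_mem l (mul_mem_block horth hC ha hx).1
    | zero => simp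
    | add x y _ _ hx hy =>
      rw [mul_add]
      exact add_mem hx hy

/-- For `x` in the intersection, each `f k * x` lies in `C k` and in the radical, hence vanishes,
while `∑ f k` acts as the identity on the sum of the blocks. -/
theorem blocks_disjoint_oddRadical (hJ : IsIdeal (oddRadical 𝒜)) :
    Disjoint (⨆ k, (C k).toSubmodule) (oddRadical 𝒜) := by
  refine Submodule.disjoint_def.2 fun x hx hxJ => ?_
  have hzero : ∀ k, f k * x = 0 := by
    intro k
    refine (hC k).inf_radical _ ?_ (hJ (f k) x hxJ).1
    clear hxJ
    induction hx using Submodule.iSup_induction' with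
    | mem l c hc =>
      by_cases h : k = l
      · subst h
        rwa [(hC k).unit_mul c hc]
      · rw [← (hC l).unit_mul c hc, ← mul_assoc, horth k l h, zero_mul]
        exact zero_mem _
    | zero => simp
    | add x y _ _ hx hy =>
      rw [mul_add]
      exact add_mem hx hy
  have hsum : (∑ k, f k) * x = x := by
    clear hxJ hzero
    induction hx using Submodule.iSup_induction' with
    | mem l c hc =>
      rw [Finset.sum_mul, Finset.sum_eq_single l]
      · exact (hC l).unit_mul c hc
      · intro k _ hkl
        rw [← (hC l).unit_mul c hc, ← mul_assoc, horth k l hkl, zero_mul]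
      · simp
    | zero => simp
    | add x y _ _ hx hy => rw [mul_add, hx, hy]
  rw [← hsum, Finset.sum_mul]
  exact Finset.sum_eq_zero fun k _ => hzero k

end Assembly

theorem IsFrame.blocks_sup_oddRadical {ι : Type v} [Fintype ι] {e : ι → A} (h𝒜 : IsGrading 𝒜)
    (he : IsFrame 𝒜 e) {r : ℕ} {f : Fin r → A} {C : Fin r → NonUnitalSubalgebra F A}
    (hC : ∀ k, IsBlock 𝒜 (f k) (C k)) (hsum : ∑ k, f k = ∑ i, e i) :
    (⨆ k, (C k).toSubmodule) ⊔ oddRadical 𝒜 = ⊤ := by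
  have hle : ∀ k, (C k).toSubmodule ≤ ⨆ k, (C k).toSubmodule := le_iSup fun k => (C k).toSubmodule
  refine eq_top_iff.2 fun a _ => ?_
  obtain ⟨a₀, h0, a₁, h1, rfl⟩ := exists_add_of_isCompl h𝒜.isCompl a
  refine add_mem ?_ ?_
  · rw [← he.sum_mul a₀ h0, ← hsum, Finset.sum_mul]
    exact sum_mem fun k _ => Submodule.mem_sup_left (hle k ((hC k).even_mem a₀ h0))
  · have hs : ∑ i, e i ∈ 𝒜 0 := sum_mem fun i _ => he.mem i
    -- The sum `∑ e i` kills the difference `a₁ - (∑ e i) * a₁`, which therefore lies in the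
    -- radical; the remaining term splits along the `f k`.
    rw [← sub_add_cancel a₁ ((∑ i, e i) * a₁)]
    refine add_mem (Submodule.mem_sup_right ?_) ?_
    · refine he.mem_oddRadical_of_sum_mul h𝒜 (sub_mem h1 (h𝒜.mul_mem_zero_one hs h1)) ?_
      rw [mul_sub, ← mul_assoc, he.sum_mul _ hs, sub_self]
      exact zero_mem _
    · rw [← hsum, Finset.sum_mul]
      exact sum_mem fun k _ => sup_le_sup_right (hle k) _ ((hC k).odd_mem a₁ h1)

end GradedAlg

theorem mainTheorem5 {F : Type u} [Field F] [Finite F] [CharP F 2] (q : ℕ) (hq : Nat.card F = q)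
    {A : Type v} [NonUnitalRing A] [Module F A] [IsScalarTower F A A] [SMulCommClass F A A]
    [FiniteDimensional F A] (𝒜 : ZMod 2 → Submodule F A) (h𝒜 : GradedAlg.IsGrading 𝒜)
    (hpow : ∀ y ∈ 𝒜 0, GradedAlg.posPow y q = y) :
    ∃ (B : NonUnitalSubalgebra F A) (r : ℕ) (C : Fin r → NonUnitalSubalgebra F A),
      -- `B` is a graded subalgebra and `A` is the direct sum of the subspaces `B` and `J^gr(A)`
      GradedAlg.IsGradedSubspace 𝒜 B.toSubmodule ∧
      IsCompl B.toSubmodule (GradedAlg.gradedJacobson 𝒜) ∧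
      -- `B` is the direct sum of the `C i`
      iSupIndep (fun i => (C i).toSubmodule) ∧
      (⨆ i, (C i).toSubmodule) = B.toSubmodule ∧
      -- each `C i` is a graded ideal of `B`, is graded simple, and is one of the three models
      ∀ i, GradedAlg.IsGradedSubspace 𝒜 (C i).toSubmodule ∧
        (∀ b ∈ B, ∀ x ∈ C i, b * x ∈ C i ∧ x * b ∈ C i) ∧
        GradedAlg.IsGradedSimple (GradedAlg.inducedGrading 𝒜 (C i)) ∧
        (GradedAlg.GradedIso (GradedAlg.inducedGrading 𝒜 (C i)) (GradedAlg.fieldGrading F) ∨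
          GradedAlg.GradedIso (GradedAlg.inducedGrading 𝒜 (C i))
            (GradedAlg.groupAlgebraGrading F) ∨
          GradedAlg.GradedIso (GradedAlg.inducedGrading 𝒜 (C i))
            (GradedAlg.matrixGrading F)) := by

  obtain ⟨ι, _, e, he⟩ := h𝒜.exists_isFrame (by rwa [hq])
  have hJ := he.oddRadical_isIdeal h𝒜
  obtain ⟨r, f, C, horth, hsum, hC⟩ := he.exists_blocks h𝒜
  have hB : (GradedAlg.blockSum horth hC).toSubmodule = ⨆ k, (C k).toSubmodule := rfl
  refine ⟨GradedAlg.blockSum horth hC, r, C, ?_, ?_, GradedAlg.blocks_iSupIndep horth hC, hB.symm,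
    fun k => ⟨(hC k).graded, fun b hb x hx => GradedAlg.mul_mem_block horth hC hb hx,
      (hC k).simple, (hC k).model⟩⟩
  · rw [hB]
    refine le_antisymm (iSup_le fun k => ?_) (iSup_le fun g => inf_le_left)
    rw [(hC k).graded]
    exact iSup_mono fun g => inf_le_inf_right _ (le_iSup (fun k => (C k).toSubmodule) k)
  · rw [hB, he.gradedJacobson_eq_oddRadical h𝒜]
    exact ⟨GradedAlg.blocks_disjoint_oddRadical horth hC hJ,
      codisjoint_iff.2 (he.blocks_sup_oddRadical h𝒜 hC hsum)⟩
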